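/- For an ideal $I$ of subsets of a set $X$ and $A\subseteq X$, write $[A]_I$ for the class of $A$ in the Boolean algebra $\mathcal P(X)/I$; let $\mathrm{Fin}$ and $\mathrm{Ctble}$ be the ideals of finite and of countable subsets of $X$. An automorphism $\pi$ of $\mathcal P(X)/I$ is *trivial* if there is a function $f:X\to X$ such that $\pi([A]_I)=[f^{-1}(A)]_I$ for all $A\subseteq X$; it is *trivial on* $Z\subseteq X$ if there is a function $f:X\to X$ such that $\pi([A]_I)=[f^{-1}(A)]_I$ for all $A\subseteq Z$; and it is *cardinality-preserving* if for every $A\subseteq X$ there is $B\subseteq X$ with $|A|=|B|$ and $\pi([A]_I)=[B]_I$. A set $X\subseteq 2^\omega$ is a *$Q_B$-set* if for every $Y\subseteq X$ there is a Borel set $B\subseteq 2^\omega$ with $B\cap X=Y$. Let $\mathfrak z$ be the least cardinality of a subset of $2^\omega$ that is not a $Q_B$-set. If $\mathfrak z>\aleph_1$, then both of the following hold. 1. Every automorphism of $\mathcal P(\mathbb R)/\mathrm{Ctble}$ is trivial. 2. Every cardinality-preserving automorphism of $\mathcal P(\mathbb R)/\mathrm{Fin}$ is trivial on some $Z\subseteq\mathbb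 R$ with $\mathbb R\setminus Z$ countable. -/

import Mathlib

open Cardinal
open scoped MeasureTheory

universe u

noncomputable section

/-- Equality modulo an ideal `I` of subsets of `X`: the symmetric difference lies in `I`. -/
def modSetoid {X : Type*} (I : Order.Ideal (Set X)) : Setoid (Set X) where
  r A B := symmDiff A B ∈ I
  iseqv :=
    { refl := fun A => by
        rw [symmDiff_self]
        exact I.bot_mem
      symm := fun {A B} h => by
        rw [symmDiff_comm]
        exact h
      trans := fun {A B C} h₁ h₂ =>
        I.lower (symmDiff_triangle A B C) (I.sup_mem h₁ h₂) }

/-- The quotient `P(X)/I`. -/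
def PowMod {X : Type*} (I : Order.Ideal (Set X)) : Type _ := Quotient (modSetoid I)

namespace PowMod

variable {X : Type*} {I : Order.Ideal (Set X)}

/-- The class `[A]` of `A ⊆ X` in `P(X)/I`. -/
def mk (I : Order.Ideal (Set X)) (A : Set X) : PowMod I := Quotient.mk (modSetoid I) A

theorem mk_eq_mk {A B : Set X} : mk I A = mk I B ↔ symmDiff A B ∈ I :=
  Quotient.eq (r := modSetoid I)

theorem symmDiff_mem_iff {A B : Set X} : symmDiff A B ∈ I ↔ A \ B ∈ I ∧ B \ A ∈ I :=
  Order.Ideal.sup_mem_iff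

/-- `[A] ≤ [B]` means that `A \ B ∈ I`. -/
instance : LE (PowMod I) where
  le := Quotient.lift₂ (s₁ := modSetoid I) (s₂ := modSetoid I) (fun A B => A \ B ∈ I) (by
    intro A B A' B' hA hB
    have hA' := symmDiff_mem_iff.1 (show symmDiff A A' ∈ I from hA)
    have hB' := symmDiff_mem_iff.1 (show symmDiff B B' ∈ I from hB)
    refine propext ⟨fun h => ?_, fun h => ?_⟩
    · refine I.lower ?_ (I.sup_mem (I.sup_mem hA'.2 h) hB'.1)
      intro x hx
      simp only [Set.sup_eq_union, Set.mem_union, Set.mem_sdiff] at hx ⊢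
      tauto
    · refine I.lower ?_ (I.sup_mem (I.sup_mem hA'.1 h) hB'.2)
      intro x hx
      simp only [Set.sup_eq_union, Set.mem_union, Set.mem_sdiff] at hx ⊢
      tauto)

theorem mk_le_mk {A B : Set X} : mk I A ≤ mk I B ↔ A \ B ∈ I := Iff.rfl

theorem mk_le_mk_of_subset {A B : Set X} (h : A ⊆ B) : mk I A ≤ mk I B := by
  rw [mk_le_mk, Set.sdiff_eq_empty.2 h]
  exact I.bot_mem

theorem ind {p : PowMod I → Prop} (h : ∀ A, p (mk I A)) (a : PowMod I) : p a :=
  Quotient.ind h a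

instance : PartialOrder (PowMod I) where
  le_refl := ind fun A => mk_le_mk_of_subset subset_rfl
  le_trans := ind fun A => ind fun B => ind fun C => by
    intro h₁ h₂
    rw [mk_le_mk] at h₁ h₂ ⊢
    refine I.lower ?_ (I.sup_mem h₁ h₂)
    intro x hx
    simp only [Set.sup_eq_union, Set.mem_union, Set.mem_sdiff] at hx ⊢
    tauto
  le_antisymm := ind fun A => ind fun B => by
    intro h₁ h₂
    exact mk_eq_mk.2 (symmDiff_mem_iff.2 ⟨h₁, h₂⟩)

theorem mk_congr {A B A' B' C D : Set X} (hA : symmDiff A A' ∈ I) (hB : symmDiff B B' ∈ I)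
    (h : symmDiff C D ⊆ symmDiff A A' ∪ symmDiff B B') : symmDiff C D ∈ I :=
  I.lower h (I.sup_mem hA hB)

/-- The Boolean algebra structure of `P(X)/I`, with the operations induced by union, intersection
and complement of representatives. -/
instance : BooleanAlgebra (PowMod I) where
  sup := Quotient.map₂ (sa := modSetoid I) (sb := modSetoid I) (sc := modSetoid I)
    (fun A B => A ∪ B) (by
      intro A A' hA B B' hB
      refine mk_congr hA hB ?_
      intro x hx
      simp only [Set.mem_symmDiff, Set.mem_union] at hx ⊢
      tauto)
  inf := Quotient.map₂ (sa := modSetoid I) (sb := modSetoid I) (sc := modSetoid I)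
    (fun A B => A ∩ B) (by
      intro A A' hA B B' hB
      refine mk_congr hA hB ?_
      intro x hx
      simp only [Set.mem_symmDiff, Set.mem_union, Set.mem_inter_iff] at hx ⊢
      tauto)
  compl := Quotient.map (sa := modSetoid I) (sb := modSetoid I) (fun A => Aᶜ) (by
      intro A A' hA
      refine mk_congr hA hA ?_
      intro x hx
      simp only [Set.mem_symmDiff, Set.mem_union, Set.mem_compl_iff] at hx ⊢
      tauto)
  top := mk I Set.univ
  bot := mk I ∅
  le_sup_left := ind fun A => ind fun B => mk_le_mk_of_subset Set.subset_union_left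
  le_sup_right := ind fun A => ind fun B => mk_le_mk_of_subset Set.subset_union_right
  sup_le := ind fun A => ind fun B => ind fun C => by
    intro h₁ h₂
    refine I.lower ?_ (I.sup_mem (mk_le_mk.1 h₁) (mk_le_mk.1 h₂))
    intro x hx
    simp only [Set.sup_eq_union, Set.mem_union, Set.mem_sdiff] at hx ⊢
    tauto
  inf_le_left := ind fun A => ind fun B => mk_le_mk_of_subset Set.inter_subset_left
  inf_le_right := ind fun A => ind fun B => mk_le_mk_of_subset Set.inter_subset_right
  le_inf := ind fun A => ind fun B => ind fun C => by
    intro h₁ h₂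
    refine I.lower ?_ (I.sup_mem (mk_le_mk.1 h₁) (mk_le_mk.1 h₂))
    intro x hx
    simp only [Set.sup_eq_union, Set.mem_union, Set.mem_sdiff, Set.mem_inter_iff] at hx ⊢
    tauto
  le_sup_inf := ind fun A => ind fun B => ind fun C =>
    mk_le_mk_of_subset (Set.union_inter_distrib_left A B C).ge
  inf_compl_le_bot := ind fun A => mk_le_mk_of_subset (Set.inter_compl_self A).le
  top_le_sup_compl := ind fun A => mk_le_mk_of_subset (Set.union_compl_self A).ge
  le_top := ind fun A => mk_le_mk_of_subset (Set.subset_univ A)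
  bot_le := ind fun A => mk_le_mk_of_subset (Set.empty_subset A)

/-- A map `π : P(X)/I → P(Y)/J` is trivial if it is induced by taking preimages under some
function `f : Y → X`. -/
def IsTrivial {X Y : Type*} {I : Order.Ideal (Set X)} {J : Order.Ideal (Set Y)}
    (π : PowMod I → PowMod J) : Prop :=
  ∃ f : Y → X, ∀ A : Set X, π (mk I A) = mk J (f ⁻¹' A)

/-- A map `π : P(X)/I → P(Y)/J` is trivial on `Z ⊆ X` if some function `f` induces it on subsets
of `Z`. The values of `f` outside of `Z` are irrelevant: `f` stands for its restriction to
`f ⁻¹' Z`, a function into `Z` whose domain represents `π [Z]`. -/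
def IsTrivialOn {X Y : Type*} {I : Order.Ideal (Set X)} {J : Order.Ideal (Set Y)}
    (π : PowMod I → PowMod J) (Z : Set X) : Prop :=
  ∃ f : Y → X, ∀ A : Set X, A ⊆ Z → π (mk I A) = mk J (f ⁻¹' A)

/-- `π : P(X)/I → P(Y)/J` is cardinality-preserving if `π [A]` has, for every `A ⊆ X`, a
representative of the same cardinality as `A`. -/
def IsCardPreserving {X Y : Type u} {I : Order.Ideal (Set X)} {J : Order.Ideal (Set Y)}
    (π : PowMod I → PowMod J) : Prop :=
  ∀ A : Set X, ∃ B : Set Y, #A = #B ∧ π (mk I A) = mk J B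

end PowMod

/-- The ideal of subsets of `X` of cardinality less than the infinite cardinal `κ`. -/
def smallIdeal (X : Type*) (κ : Cardinal) (hκ : ℵ₀ ≤ κ) : Order.Ideal (Set X) where
  carrier := {A | #A < κ}
  lower' := fun _ _ hBA hA => (mk_le_mk_of_subset hBA).trans_lt hA
  nonempty' := ⟨∅, by simpa using aleph0_pos.trans_le hκ⟩
  directed' := fun A hA B hB => ⟨A ∪ B,
    (mk_union_le A B).trans_lt (add_lt_of_lt hκ hA hB),
    Set.subset_union_left, Set.subset_union_right⟩

/-- The ideal of finite subsets of `X`. -/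
abbrev finIdeal (X : Type*) : Order.Ideal (Set X) := smallIdeal X ℵ₀ le_rfl

/-- The ideal of countable subsets of `X`. -/
abbrev ctbleIdeal (X : Type*) : Order.Ideal (Set X) := smallIdeal X ℵ₁ (aleph0_le_aleph 1)

/-- `X ⊆ 2^ω` is a `Q_B`-set if each of its subsets is the trace on `X` of a Borel subset of
`2^ω`. -/
def IsQBSet (X : Set (ℕ → Bool)) : Prop :=
  ∀ Y ⊆ X, ∃ B : Set (ℕ → Bool), MeasurableSet[borel (ℕ → Bool)] B ∧ B ∩ X = Y

/-- The cardinal `𝔷`: the least cardinality of a subset of `2^ω` that is not a `Q_B`-set. -/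
def cardinalZ : Cardinal.{0} :=
  sInf {κ | ∃ X : Set (ℕ → Bool), ¬ IsQBSet X ∧ #X = κ}

/-- Not every subset of `2^ω` is Borel, so the minimum defining `𝔷` is attained. -/
theorem cardinalZ_attained : ∃ X : Set (ℕ → Bool), ¬ IsQBSet X ∧ #X = cardinalZ := by
  refine csInf_mem (s := {κ | ∃ X : Set (ℕ → Bool), ¬ IsQBSet X ∧ #X = κ})
    ⟨_, Set.univ, fun h => ?_, rfl⟩
  have hB : ∀ Y : Set (ℕ → Bool), MeasurableSet[borel (ℕ → Bool)] Y := fun Y => by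
    obtain ⟨B, hB, rfl⟩ := h Y (Set.subset_univ Y)
    rwa [Set.inter_univ]
  have hc : #{Y : Set (ℕ → Bool) | MeasurableSet[borel (ℕ → Bool)] Y} ≤ 𝔠 := by
    have e := TopologicalSpace.IsTopologicalBasis.borel_eq_generateFrom
      (TopologicalSpace.isBasis_countableBasis (ℕ → Bool))
    rw [e]
    exact MeasurableSpace.cardinal_measurableSet_le_continuum
      ((TopologicalSpace.countable_countableBasis _).le_aleph0.trans aleph0_le_continuum)
  have hu : {Y : Set (ℕ → Bool) | MeasurableSet[borel (ℕ → Bool)] Y} = Set.univ :=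
    Set.eq_univ_of_forall hB
  rw [hu, mk_univ, mk_set] at hc
  have h2 : #(ℕ → Bool) = 𝔠 := by simp
  rw [h2] at hc
  exact (cantor 𝔠).not_ge hc

end

/-! Modulo countable sets an automorphism respects countable unions, so after coding points by
elements of `2^ω` its values on the coordinate sets determine a map `g` inducing it on all Borel
sets. Pulled back through the coding, `g` becomes the candidate `f`. If `f` failed on some `A` by an
uncountable set, the failure would be visible on sets of size `ℵ₁`, which `ℵ₁ < 𝔷` separates by a
Borel set, where `g` is correct (`exists_function`). Modulo finite sets, preservation of cardinality
lets the same argument give `f` correct up to countable errors. Any failure modulo finite yields a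
countable bad pair. A maximal disjoint family of bad pairs is countable, since an uncountable one
would give an uncountable error of `f`; discarding its union, together with what `π` and `f` make of
it, removes all failures. -/

theorem isQBSet_of_mk_lt_cardinalZ {S : Set (ℕ → Bool)} (h : #S < cardinalZ) : IsQBSet S := by
  by_contra hS
  exact notMem_of_lt_csInf' h ⟨S, hS, rfl⟩

/-- Disjoint sets of size at most `ℵ₁` can be separated by Borel sets if `ℵ₁ < 𝔷`. -/
theorem exists_borel_separating (hz : ℵ₁ < cardinalZ) {S T : Set (ℕ → Bool)} (hS : #S ≤ ℵ₁)
    (hT : #T ≤ ℵ₁) (hST : Disjoint S T) :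
    ∃ B : Set (ℕ → Bool), MeasurableSet[borel (ℕ → Bool)] B ∧ S ⊆ B ∧ Disjoint T B := by
  have hU : #(S ∪ T : Set (ℕ → Bool)) < cardinalZ :=
    ((mk_union_le S T).trans (add_le_of_le (aleph0_le_aleph 1) hS hT)).trans_lt hz
  obtain ⟨B, hB, hBS⟩ := isQBSet_of_mk_lt_cardinalZ hU S Set.subset_union_left
  refine ⟨B, hB, fun x hx => ?_, Set.disjoint_left.2 fun x hxT hxB => ?_⟩
  · rw [← hBS] at hx
    exact hx.1
  · have hx : x ∈ S := by
      rw [← hBS]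
      exact ⟨hxB, Or.inr hxT⟩
    exact Set.disjoint_left.1 hST hx hxT

theorem countable_iff_mk_lt_aleph_one {X : Type*} {A : Set X} : A.Countable ↔ #A < ℵ₁ := by
  rw [lt_aleph_one_iff, le_aleph0_iff_set_countable]

theorem Set.Infinite.exists_countable_infinite_subset {X : Type*} {A : Set X}
    (h : A.Infinite) : ∃ B ⊆ A, B.Infinite ∧ B.Countable := by
  refine ⟨Set.range fun n => (h.natEmbedding A n : X), ?_, Set.infinite_range_of_injective
    (Subtype.val_injective.comp (h.natEmbedding A).injective), Set.countable_range _⟩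
  rintro _ ⟨n, rfl⟩
  exact (h.natEmbedding A n).2

theorem countable_sdiff_trans {X : Type*} {A B C : Set X} (h₁ : (A \ B).Countable)
    (h₂ : (B \ C).Countable) : (A \ C).Countable := by
  refine (h₁.union h₂).mono fun x hx => ?_
  by_cases hB : x ∈ B
  · exact Or.inr ⟨hB, hx.2⟩
  · exact Or.inl ⟨hx.1, hB⟩

theorem exists_subset_mk_eq_aleph_one {X : Type} {A : Set X} (h : ¬ A.Countable) :
    ∃ B ⊆ A, #B = ℵ₁ := by
  refine le_mk_iff_exists_subset.1 (not_lt.1 fun h' => h ?_)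
  exact countable_iff_mk_lt_aleph_one.2 h'

/-! ### Automorphisms modulo countable sets -/

/-- A map between power sets representing an automorphism modulo the countable sets. -/
structure IsCtbleLift {X Y : Type} (Φ : Set X → Set Y) : Prop where
  sdiff_iff : ∀ A B, (A \ B).Countable ↔ (Φ A \ Φ B).Countable
  surj : ∀ B, ∃ A, (Φ A \ B).Countable ∧ (B \ Φ A).Countable
  compl : ∀ A, (Φ Aᶜ \ (Φ A)ᶜ).Countable ∧ ((Φ A)ᶜ \ Φ Aᶜ).Countable

namespace IsCtbleLift

variable {X Y : Type} {Φ : Set X → Set Y}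

theorem countable_empty (h : IsCtbleLift Φ) : (Φ ∅).Countable := by
  obtain ⟨A, hA, -⟩ := h.surj ∅
  have h₁ := countable_sdiff_trans ((h.sdiff_iff ∅ A).1 (by simp)) hA
  simpa using h₁

theorem countable_iff (h : IsCtbleLift Φ) (A : Set X) : A.Countable ↔ (Φ A).Countable := by
  have h₁ := h.sdiff_iff A ∅
  rw [Set.sdiff_empty] at h₁
  rw [h₁]
  refine ⟨fun h₂ => (h₂.union h.countable_empty).mono fun x hx => ?_,
    fun h₂ => h₂.mono Set.sdiff_subset⟩
  by_cases h' : x ∈ Φ ∅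
  · exact Or.inr h'
  · exact Or.inl ⟨hx, h'⟩

/-- Countable sets form a σ-ideal, so a countable union is a least upper bound modulo countable, and
an order isomorphism preserves it. -/
theorem iUnion (h : IsCtbleLift Φ) (A : ℕ → Set X) :
    (Φ (⋃ n, A n) \ ⋃ n, Φ (A n)).Countable ∧ ((⋃ n, Φ (A n)) \ Φ (⋃ n, A n)).Countable := by
  constructor
  · obtain ⟨C, hC, hC'⟩ := h.surj (⋃ n, Φ (A n))
    refine countable_sdiff_trans ((h.sdiff_iff _ C).1 ?_) hC
    rw [Set.iUnion_sdiff]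
    refine Set.countable_iUnion fun n => (h.sdiff_iff _ _).2 ?_
    exact hC'.mono (Set.sdiff_subset_sdiff_left (Set.subset_iUnion (fun n => Φ (A n)) n))
  · rw [Set.iUnion_sdiff]
    refine Set.countable_iUnion fun n => (h.sdiff_iff _ _).1 ?_
    rw [Set.sdiff_eq_empty.2 (Set.subset_iUnion A n)]
    exact Set.countable_empty

/-- The preimages of Borel sets under a coding of `X` are lifted to preimages. -/
theorem exists_borel_lift (h : IsCtbleLift Φ) (e : X → ℕ → Bool) :
    ∃ g : Y → ℕ → Bool, ∀ B : Set (ℕ → Bool), MeasurableSet[borel (ℕ → Bool)] B →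
      (Φ (e ⁻¹' B) \ g ⁻¹' B).Countable ∧ (g ⁻¹' B \ Φ (e ⁻¹' B)).Countable := by
  classical
  have hborel : borel (ℕ → Bool) = MeasurableSpace.pi :=
    (inferInstance : BorelSpace (ℕ → Bool)).measurable_eq.symm
  let g : Y → ℕ → Bool := fun y n => decide (y ∈ Φ {x | e x n = true})
  refine ⟨g, ?_⟩
  -- The sets on which `g` is correct form a σ-algebra; by the choice of `g` it contains the
  -- coordinate sets, hence all Borel sets.
  let m : MeasurableSpace (ℕ → Bool) :=
    { MeasurableSet' := fun B =>
        (Φ (e ⁻¹' B) \ g ⁻¹' B).Countable ∧ (g ⁻¹' B \ Φ (e ⁻¹' B)).Countable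
      measurableSet_empty := by
        simpa using h.countable_empty
      measurableSet_compl := by
        intro B hB
        rw [Set.preimage_compl, Set.preimage_compl]
        obtain ⟨h₁, h₂⟩ := h.compl (e ⁻¹' B)
        refine ⟨countable_sdiff_trans h₁ (hB.2.mono ?_), countable_sdiff_trans (hB.1.mono ?_) h₂⟩
        · rintro x ⟨hx, hx'⟩
          exact ⟨not_not.1 hx', hx⟩
        · rintro x ⟨hx, hx'⟩
          exact ⟨not_not.1 hx', hx⟩
      measurableSet_iUnion := by
        intro B hB
        rw [Set.preimage_iUnion, Set.preimage_iUnion]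
        obtain ⟨h₁, h₂⟩ := h.iUnion fun n => e ⁻¹' B n
        refine ⟨countable_sdiff_trans h₁ ?_, countable_sdiff_trans ?_ h₂⟩ <;>
          rw [Set.iUnion_sdiff]
        · refine Set.countable_iUnion fun n => (hB n).1.mono ?_
          exact Set.sdiff_subset_sdiff_right (Set.subset_iUnion (fun n => g ⁻¹' B n) n)
        · refine Set.countable_iUnion fun n => (hB n).2.mono ?_
          exact Set.sdiff_subset_sdiff_right (Set.subset_iUnion (fun n => Φ (e ⁻¹' B n)) n) }
  have hle : borel (ℕ → Bool) ≤ m := by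
    rw [hborel]
    refine iSup_le fun n => ?_
    rintro _ ⟨s, -, rfl⟩
    have key : MeasurableSet[m] {z : ℕ → Bool | z n = true} := by
      have hg : g ⁻¹' {z | z n = true} = Φ (e ⁻¹' {z | z n = true}) := by
        ext y
        simp [g]
      change Set.Countable _ ∧ Set.Countable _
      rw [hg]
      simp
    have key' : MeasurableSet[m] {z : ℕ → Bool | z n = false} := by
      convert key.compl using 1
      ext z
      simp
    have hs : (fun z : ℕ → Bool => z n) ⁻¹' s =
        ({z | z n = true} ∩ {_z | true ∈ s}) ∪ ({z | z n = false} ∩ {_z | false ∈ s}) := by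
      ext z
      cases hzn : z n <;> simp [hzn]
    rw [hs]
    exact (key.inter (MeasurableSet.const _)).union (key'.inter (MeasurableSet.const _))
  exact fun B hB => hle B hB

/-- If `ℵ₁ < 𝔷`, then every automorphism modulo the countable sets is induced by a function. -/
theorem exists_function (hz : ℵ₁ < cardinalZ) (h : IsCtbleLift Φ) (e : X ≃ (ℕ → Bool)) :
    ∃ f : Y → X, ∀ A, (Φ A \ f ⁻¹' A).Countable ∧ (f ⁻¹' A \ Φ A).Countable := by
  obtain ⟨g, hg⟩ := h.exists_borel_lift e
  have key : ∀ A, (Φ A \ (fun y => e.symm (g y)) ⁻¹' A).Countable := by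
    intro A
    by_contra hA
    obtain ⟨W, hWA, hW⟩ := exists_subset_mk_eq_aleph_one hA
    have hWc : ¬ W.Countable := fun hc => by
      have := countable_iff_mk_lt_aleph_one.1 hc
      exact this.ne hW
    -- The error set `W` is pulled back and thinned to a `Y₀ ⊆ A` of size `ℵ₁` whose image is
    -- uncountable and almost inside `W`.
    obtain ⟨Y₁, hY₁, hY₁'⟩ := h.surj W
    have hY₁A : (Y₁ \ A).Countable :=
      (h.sdiff_iff _ _).2 (countable_sdiff_trans hY₁
        (by rw [Set.sdiff_eq_empty.2 fun x hx => (hWA hx).1]; exact Set.countable_empty))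
    have hYA : ¬ (Y₁ ∩ A).Countable := fun hc => by
      have hc₁ : Y₁.Countable := by
        rw [← Set.inter_union_sdiff Y₁ A]
        exact hc.union hY₁A
      refine hWc (((h.countable_iff Y₁).1 hc₁).union hY₁' |>.mono fun x hx => ?_)
      by_cases hx' : x ∈ Φ Y₁
      · exact Or.inl hx'
      · exact Or.inr ⟨hx, hx'⟩
    obtain ⟨Y₀, hY₀, hY₀c⟩ := exists_subset_mk_eq_aleph_one hYA
    have hΦ : ¬ (Φ Y₀).Countable := fun hc => by
      have := countable_iff_mk_lt_aleph_one.1 ((h.countable_iff Y₀).2 hc)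
      exact this.ne hY₀c
    have hΦW : (Φ Y₀ \ W).Countable := by
      refine countable_sdiff_trans ((h.sdiff_iff Y₀ Y₁).1 ?_) hY₁
      rw [Set.sdiff_eq_empty.2 fun x hx => (hY₀ hx).1]
      exact Set.countable_empty
    -- `e '' Y₀` lies in `e '' A`, which `g '' W` avoids. With `B` between them, `Φ Y₀` is almost
    -- inside both `W` and `g ⁻¹' B`, which are disjoint.
    obtain ⟨B, hB, hB₁, hB₂⟩ := exists_borel_separating hz (S := e '' Y₀) (T := g '' W)
      (mk_image_le.trans hY₀c.le) (mk_image_le.trans hW.le) (by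
        rw [Set.disjoint_left]
        rintro _ ⟨x, hx, rfl⟩ ⟨w, hw, hwx⟩
        refine (hWA hw).2 ?_
        rw [Set.mem_preimage, hwx, e.symm_apply_apply]
        exact (hY₀ hx).2)
    have h₁ : (Φ Y₀ \ g ⁻¹' B).Countable := by
      refine countable_sdiff_trans ((h.sdiff_iff Y₀ (e ⁻¹' B)).1 ?_) (hg B hB).1
      rw [Set.sdiff_eq_empty.2 (Set.image_subset_iff.1 hB₁)]
      exact Set.countable_empty
    refine hΦ ((hΦW.union h₁).mono fun y hy => ?_)
    by_cases hyW : y ∈ W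
    · exact Or.inr ⟨hy, fun hyB => Set.disjoint_left.1 hB₂ ⟨y, hyW, rfl⟩ hyB⟩
    · exact Or.inl ⟨hy, hyW⟩
  refine ⟨fun y => e.symm (g y), fun A => ⟨key A, ?_⟩⟩
  -- The reverse inclusion for `A` is the one already shown for `Aᶜ`.
  refine ((key Aᶜ).union (h.compl A).2).mono fun y hy => ?_
  by_cases hy' : y ∈ Φ Aᶜ
  · exact Or.inl ⟨hy', fun hn => hn hy.1⟩
  · exact Or.inr ⟨hy.2, hy'⟩

end IsCtbleLift

/-! ### Representatives of classes in the quotients -/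

namespace PowMod

variable {X Y : Type u} {I : Order.Ideal (Set X)} {J : Order.Ideal (Set Y)}

theorem exists_mk_eq (a : PowMod I) : ∃ A, a = mk I A := by
  induction a using ind with | h A => exact ⟨A, rfl⟩

theorem mk_eq_bot {A : Set X} : mk I A = ⊥ ↔ A ∈ I := by
  change mk I A = mk I ∅ ↔ _
  rw [mk_eq_mk, ← Set.bot_eq_empty, symmDiff_bot]

section Lift

variable {π : PowMod I ≃o PowMod J} {A B : Set X} {A' B' : Set Y}

theorem map_mk_compl (hA : π (mk I A) = mk J A') : π (mk I Aᶜ) = mk J A'ᶜ := by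
  change π (mk I A)ᶜ = (mk J A')ᶜ
  rw [← hA, map_compl' π]

theorem map_mk_inter (hA : π (mk I A) = mk J A') (hB : π (mk I B) = mk J B') :
    π (mk I (A ∩ B)) = mk J (A' ∩ B') := by
  change π (mk I A ⊓ mk I B) = mk J A' ⊓ mk J B'
  rw [← hA, ← hB, π.map_inf]

theorem map_mk_sdiff (hA : π (mk I A) = mk J A') (hB : π (mk I B) = mk J B') :
    π (mk I (A \ B)) = mk J (A' \ B') :=
  map_mk_inter hA (map_mk_compl hB)

theorem mem_iff_of_map_mk (hA : π (mk I A) = mk J A') : A ∈ I ↔ A' ∈ J := by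
  rw [← mk_eq_bot, ← mk_eq_bot (I := J), ← hA, map_eq_bot_iff]

theorem sdiff_mem_iff_of_map_mk (hA : π (mk I A) = mk J A') (hB : π (mk I B) = mk J B') :
    A \ B ∈ I ↔ A' \ B' ∈ J :=
  mem_iff_of_map_mk (map_mk_sdiff hA hB)

/-- A smaller class has a preimage represented by a subset. -/
theorem exists_subset_map_mk (hA : π (mk I A) = mk J A') (h : B' ⊆ A') :
    ∃ B ⊆ A, π (mk I B) = mk J B' := by
  obtain ⟨B, hB⟩ := exists_mk_eq (π.symm (mk J B'))
  have hB' : π (mk I B) = mk J B' := by rw [← hB, π.apply_symm_apply]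
  refine ⟨A ∩ B, Set.inter_subset_left, ?_⟩
  rw [map_mk_inter hA hB', Set.inter_eq_self_of_subset_right h]

end Lift

theorem mem_finIdeal {A : Set X} : A ∈ finIdeal X ↔ A.Finite := lt_aleph0_iff_set_finite

theorem mem_ctbleIdeal {A : Set X} : A ∈ ctbleIdeal X ↔ A.Countable :=
  countable_iff_mk_lt_aleph_one.symm

theorem IsCardPreserving.countable_iff {π : PowMod (finIdeal X) ≃o PowMod (finIdeal Y)}
    (hπ : IsCardPreserving π) {A : Set X} {A' : Set Y}
    (hA : π (mk _ A) = mk _ A') : A.Countable ↔ A'.Countable := by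
  obtain ⟨B, hAB, hB⟩ := hπ A
  have hc : A.Countable ↔ B.Countable := by
    rw [← le_aleph0_iff_set_countable, hAB, le_aleph0_iff_set_countable]
  rw [hA, mk_eq_mk, symmDiff_mem_iff, mem_finIdeal, mem_finIdeal] at hB
  rw [hc]
  refine ⟨fun h => (h.union hB.1.countable).mono fun x hx => ?_,
    fun h => (h.union hB.2.countable).mono fun x hx => ?_⟩
  · exact or_iff_not_imp_left.2 fun hx' => ⟨hx, hx'⟩
  · exact or_iff_not_imp_left.2 fun hx' => ⟨hx, hx'⟩

/-- If `J` consists of countable sets and `π` preserves countability, then a choice of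
representatives for `π` is an automorphism modulo countable sets. -/
theorem isCtbleLift_of_map_mk {X Y : Type} {I : Order.Ideal (Set X)} {J : Order.Ideal (Set Y)}
    (hJ : ∀ B ∈ J, B.Countable) (π : PowMod I ≃o PowMod J)
    (hc : ∀ A A', π (mk I A) = mk J A' → (A.Countable ↔ A'.Countable))
    {Φ : Set X → Set Y} (hΦ : ∀ A, π (mk I A) = mk J (Φ A)) : IsCtbleLift Φ where
  sdiff_iff A B := hc _ _ (map_mk_sdiff (hΦ A) (hΦ B))
  surj B := by
    obtain ⟨A, hA⟩ := exists_mk_eq (π.symm (mk J B))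
    have h := hΦ A
    rw [← hA, π.apply_symm_apply, mk_eq_mk, symmDiff_mem_iff] at h
    exact ⟨A, hJ _ h.2, hJ _ h.1⟩
  compl A := by
    have h := hΦ Aᶜ
    rw [map_mk_compl (hΦ A), mk_eq_mk, symmDiff_mem_iff] at h
    exact ⟨hJ _ h.2, hJ _ h.1⟩

/-! ### From errors modulo countable to errors modulo finite -/

section Fin

variable {X Y : Type} {π : PowMod (finIdeal X) ≃o PowMod (finIdeal Y)} {f : Y → X}

/-- A witness that `f` does not induce `π` on a countable set. -/
structure IsBadPair (π : PowMod (finIdeal X) ≃o PowMod (finIdeal Y)) (f : Y → X)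
    (p : Set X × Set Y) : Prop where
  map_eq : π (mk _ p.1) = mk _ p.2
  countable_fst : p.1.Countable
  countable_snd : p.2.Countable
  infinite_snd : p.2.Infinite
  disjoint : Disjoint p.2 (f ⁻¹' p.1)

theorem IsBadPair.nonempty_fst {p : Set X × Set Y} (h : IsBadPair π f p) : p.1.Nonempty := by
  rw [Set.nonempty_iff_ne_empty]
  intro h₀
  have h₁ := mem_iff_of_map_mk h.map_eq
  rw [mem_finIdeal, mem_finIdeal, h₀] at h₁
  exact h.infinite_snd (h₁.1 Set.finite_empty)

/-- If `f` induces `π` modulo countable sets, then some countable set meets all bad pairs. -/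
theorem exists_countable_meeting_isBadPair
    (hf : ∀ A A', π (mk _ A) = mk _ A' → (A' \ f ⁻¹' A).Countable) :
    ∃ N : Set X, N.Countable ∧ ∀ p, IsBadPair π f p → ¬ Disjoint (p.1 ∪ f '' p.2) N := by
  let T : Set X × Set Y → Set X := fun p => p.1 ∪ f '' p.2
  obtain ⟨F, hF⟩ := zorn_subset
    {F : Set (Set X × Set Y) | (∀ p ∈ F, IsBadPair π f p) ∧ F.PairwiseDisjoint T} (by
      intro c hc hchain
      refine ⟨⋃₀ c, ⟨?_, ?_⟩, fun s hs => Set.subset_sUnion_of_mem hs⟩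
      · rintro p ⟨s, hs, hp⟩
        exact (hc hs).1 p hp
      · exact (Set.pairwiseDisjoint_sUnion hchain.directedOn).2 fun s hs => (hc hs).2)
  obtain ⟨hFbad, hFdisj⟩ := hF.prop
  have hFc : F.Countable := by
    -- Each `p.2` is almost inside `D'`, so it contributes a point `y p` of `D'`. Badness of `p` and
    -- disjointness from the other pairs keep `f (y p)` out of the union, so these distinct points
    -- all lie in a countable error set.
    obtain ⟨D', hD'⟩ := exists_mk_eq (π (mk _ (⋃ p ∈ F, p.1)))
    have hcount := hf _ _ hD'
    have hpt : ∀ p : F, ∃ y, y ∈ p.1.2 ∧ y ∈ D' := by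
      intro p
      have hp := hFbad p p.2
      have hfin : (p.1.2 \ D').Finite := by
        rw [← mem_finIdeal, ← sdiff_mem_iff_of_map_mk hp.map_eq hD',
          Set.sdiff_eq_empty.2 (Set.subset_biUnion_of_mem (u := fun p => p.1) p.2), mem_finIdeal]
        exact Set.finite_empty
      obtain ⟨y, hy, hy'⟩ := (hp.infinite_snd.sdiff hfin).nonempty
      exact ⟨y, hy, by_contra fun h => hy' ⟨hy, h⟩⟩
    choose y hy hyD using hpt
    have hyf : ∀ p, y p ∈ D' \ f ⁻¹' ⋃ p ∈ F, p.1 := by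
      refine fun p => ⟨hyD p, fun hmem => ?_⟩
      simp only [Set.mem_preimage, Set.mem_iUnion] at hmem
      obtain ⟨q, hq, hyq⟩ := hmem
      by_cases hpq : (p : Set X × Set Y) = q
      · subst hpq
        exact Set.disjoint_left.1 (hFbad p hq).disjoint (hy p) hyq
      · exact Set.disjoint_left.1 (hFdisj p.2 hq hpq) (Or.inr ⟨_, hy p, rfl⟩) (Or.inl hyq)
    have hinj : Function.Injective y := by
      intro p q hpq
      by_contra hne
      refine Set.disjoint_left.1 (hFdisj p.2 q.2 fun h => hne (Subtype.ext h))
        (Or.inr ⟨_, hy p, rfl⟩) (Or.inr ⟨y p, ?_, rfl⟩)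
      rw [hpq]
      exact hy q
    have : Countable (D' \ f ⁻¹' ⋃ p ∈ F, p.1 : Set Y) := hcount
    exact Function.Injective.countable (f := fun p : F =>
      (⟨y p, hyf p⟩ : (D' \ f ⁻¹' ⋃ p ∈ F, p.1 : Set Y)))
      fun p q h => hinj (congrArg Subtype.val h)
  refine ⟨⋃ p ∈ F, T p, hFc.biUnion fun p hp =>
    (hFbad p hp).countable_fst.union ((hFbad p hp).countable_snd.image f), fun p hp hdisj => ?_⟩
  have hins : insert p F ⊆ F := by
    refine hF.le_of_ge ⟨?_, ?_⟩ (Set.subset_insert p F)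
    · rintro q (rfl | hq)
      · exact hp
      · exact hFbad q hq
    · exact hFdisj.insert fun q hq _ =>
        hdisj.mono_right (Set.subset_biUnion_of_mem (u := T) hq)
  obtain ⟨x, hx⟩ := hp.nonempty_fst
  exact Set.disjoint_left.1 hdisj (Or.inl hx)
    (Set.mem_biUnion (hins (Set.mem_insert p F)) (Or.inl hx))

/-- An automorphism modulo finite sets that preserves countability and is induced by `f` modulo
countable sets is trivial on a set with countable complement. -/
theorem isTrivialOn_compl_countable
    (hc : ∀ A A', π (mk _ A) = mk _ A' → (A.Countable ↔ A'.Countable))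
    (hf : ∀ A A', π (mk _ A) = mk _ A' → (A' \ f ⁻¹' A).Countable ∧ (f ⁻¹' A \ A').Countable) :
    ∃ Z : Set X, Zᶜ.Countable ∧ IsTrivialOn π Z := by
  obtain ⟨N, hN, hNbad⟩ := exists_countable_meeting_isBadPair fun A A' h => (hf A A' h).1
  obtain ⟨N', hN'⟩ := exists_mk_eq (π (mk _ N))
  have hN'c : N'.Countable := (hc _ _ hN').1 hN
  have hfN : (f ⁻¹' N).Countable := by
    refine (hN'c.union (hf _ _ hN').2).mono fun x hx => ?_
    exact or_iff_not_imp_left.2 fun hx' => ⟨hx, hx'⟩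
  -- Removing `N`, `f '' N'` and `M` makes both kinds of failure below produce a bad pair missing
  -- `N`: `M` serves the first, `f '' N'` the second.
  obtain ⟨M, hM⟩ := exists_mk_eq (π.symm (mk _ (f ⁻¹' N)))
  replace hM : π (mk _ M) = mk _ (f ⁻¹' N) := by rw [← hM, π.apply_symm_apply]
  have hMc : M.Countable := (hc _ _ hM).2 hfN
  refine ⟨(N ∪ f '' N' ∪ M)ᶜ, ?_, f, fun A hA => ?_⟩
  · rw [compl_compl]
    exact (hN.union (hN'c.image f)).union hMc
  obtain ⟨A', hA'⟩ := exists_mk_eq (π (mk _ A))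
  rw [hA', mk_eq_mk, symmDiff_mem_iff, mem_finIdeal, mem_finIdeal]
  constructor
  · by_contra hinf
    obtain ⟨E, hE, hEinf, hEc⟩ := Set.Infinite.exists_countable_infinite_subset hinf
    obtain ⟨D, hDA, hD⟩ := exists_subset_map_mk hA' (hE.trans Set.sdiff_subset)
    -- As `D` misses `M`, only finitely many points of `E` are sent into `N`, and they can be
    -- dropped.
    have hfin : (E ∩ f ⁻¹' N).Finite := by
      rw [← mem_finIdeal, ← mem_iff_of_map_mk (map_mk_inter hD hM), mem_finIdeal]
      convert Set.finite_empty
      exact Set.disjoint_iff_inter_eq_empty.1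
        (Set.disjoint_left.2 fun x hx hxM => hA (hDA hx) (Or.inr hxM))
    have hE₁ : π (mk _ D) = mk _ (E \ f ⁻¹' N) := by
      rw [hD, mk_eq_mk, symmDiff_mem_iff, mem_finIdeal, mem_finIdeal, Set.sdiff_sdiff_right_self,
        Set.sdiff_eq_empty.2 Set.sdiff_subset]
      exact ⟨hfin, Set.finite_empty⟩
    refine hNbad (D, E \ f ⁻¹' N) ⟨hE₁, (hc _ _ hD).2 hEc, hEc.mono Set.sdiff_subset, ?_, ?_⟩ ?_
    · rw [← Set.sdiff_inter_self_eq_sdiff, Set.inter_comm]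
      exact hEinf.sdiff hfin
    · exact Set.disjoint_left.2 fun y hy hyD => (hE hy.1).2 (hDA hyD)
    · rw [Set.disjoint_left]
      rintro x (hx | ⟨y, hy, rfl⟩) hxN
      · exact hA (hDA hx) (Or.inl (Or.inl hxN))
      · exact hy.2 hxN
  · by_contra hinf
    obtain ⟨E, hE, hEinf, hEc⟩ := Set.Infinite.exists_countable_infinite_subset hinf
    obtain ⟨D, hD⟩ := exists_mk_eq (π.symm (mk _ E))
    replace hD : π (mk _ D) = mk _ E := by rw [← hD, π.apply_symm_apply]
    -- `E` misses `N'` and `A'`, so removing `N` and `A` from `D` does not change the image class.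
    have hD₁ : π (mk _ ((D \ N) \ A)) = mk _ E := by
      rw [map_mk_sdiff (map_mk_sdiff hD hN') hA']
      congr 1
      ext y
      refine ⟨fun h => h.1.1, fun h => ⟨⟨h, fun hy => ?_⟩, (hE h).2⟩⟩
      exact hA (hE h).1 (Or.inl (Or.inr ⟨y, hy, rfl⟩))
    refine hNbad ((D \ N) \ A, E) ⟨hD₁, (hc _ _ hD₁).2 hEc, hEc, hEinf, ?_⟩ ?_
    · exact Set.disjoint_left.2 fun y hy hyD => hyD.2 (hE hy).1
    · rw [Set.disjoint_left]
      rintro x (hx | ⟨y, hy, rfl⟩) hxN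
      · exact hx.1.2 hxN
      · exact hA (hE hy).1 (Or.inl (Or.inl hxN))

end Fin

end PowMod

theorem corollary5p5 (hz : ℵ₁ < cardinalZ) :
    (∀ π : PowMod (ctbleIdeal ℝ) ≃o PowMod (ctbleIdeal ℝ), PowMod.IsTrivial π) ∧
    (∀ π : PowMod (finIdeal ℝ) ≃o PowMod (finIdeal ℝ), PowMod.IsCardPreserving π →
      ∃ Z : Set ℝ, Zᶜ.Countable ∧ PowMod.IsTrivialOn π Z) := by
  obtain ⟨e⟩ : Nonempty (ℝ ≃ (ℕ → Bool)) := Cardinal.eq.1 (by simp [Cardinal.mk_real])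
  constructor
  · intro π
    choose Φ hΦ using fun A => PowMod.exists_mk_eq (π (PowMod.mk _ A))
    have hlift : IsCtbleLift Φ := PowMod.isCtbleLift_of_map_mk
      (fun B => PowMod.mem_ctbleIdeal.1) π (fun A A' h => by
        rw [← PowMod.mem_ctbleIdeal, ← PowMod.mem_ctbleIdeal, PowMod.mem_iff_of_map_mk h]) hΦ
    obtain ⟨f, hf⟩ := hlift.exists_function hz e
    refine ⟨f, fun A => ?_⟩
    rw [hΦ, PowMod.mk_eq_mk, PowMod.symmDiff_mem_iff, PowMod.mem_ctbleIdeal,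
      PowMod.mem_ctbleIdeal]
    exact hf A
  · intro π hπ
    choose Φ hΦ using fun A => PowMod.exists_mk_eq (π (PowMod.mk _ A))
    have hlift : IsCtbleLift Φ := PowMod.isCtbleLift_of_map_mk
      (fun B hB => (PowMod.mem_finIdeal.1 hB).countable) π (fun A A' h => hπ.countable_iff h) hΦ
    obtain ⟨f, hf⟩ := hlift.exists_function hz e
    refine PowMod.isTrivialOn_compl_countable (f := f) (fun A A' h => hπ.countable_iff h) ?_
    intro A A' h
    rw [hΦ, PowMod.mk_eq_mk, PowMod.symmDiff_mem_iff, PowMod.mem_finIdeal,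
      PowMod.mem_finIdeal] at h
    exact ⟨countable_sdiff_trans h.2.countable (hf A).1,
      countable_sdiff_trans (hf A).2 h.1.countable⟩
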